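/- Let $d\ge 4$ be an integer and let $\Lambda\subseteq\mathbb N=\{0,1,2,\dots\}$. For $\lambda\in\mathbb N$, $f:\mathbb Z^d\to\mathbb C$ and $x\in\mathbb Z^d$ put \[ A_\lambda f(x)=\frac{1}{\#\{y\in\mathbb Z^d:|y|^2=\lambda\}}\sum_{y\in\mathbb Z^d:\,|y|^2=\lambda} f(x-y), \qquad M_\Lambda f(x)=\sup_{\lambda\in\Lambda}|A_\lambda f(x)| , \] where $|y|^2=y_1^2+\dots+y_d^2$ (and $M_\emptyset f=0$). For a prime $q$ let $\delta_q(\Lambda)$ be the $q$-adic upper Minkowski dimension of $\Lambda$, that is \[ \delta_q(\Lambda)=\limsup_{\varepsilon\to0^+}\frac{\log N_q(\Lambda,\varepsilon)}{\log(1/\varepsilon)}, \] where $N_q(\Lambda,\varepsilon)$ is the least number of closed balls of radius $\varepsilon$ in the $q$-adic integers $\mathbb Z_q$, centred at points of $\Lambda$, that cover $\Lambda$ (with $\delta_q(\emptyset)=0$). Let $\delta_\infty(\Lambda)$ be the infimum of all $\delta\ge0$ for which there is a constant $C_\delta$ with $\#(\Lambda\cap[N,2N])\le C_\delta N^{\delta}$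 for all integers $N\ge1$. Define \[ \eta(\Lambda)=\max\Big\{\sup_{q\text{ prime}}\Big(1+\frac{\delta_q(\Lambda)}{d-1}\Big),\ 1+\frac{2\,\delta_\infty(\Lambda)}{d-2}\Big\}. \] Then for every real $p$ with $1\le p<\eta(\Lambda)$, and, if $\Lambda$ is infinite, for every real $p$ with $0<p<\eta(\Lambda)$, the operator $M_\Lambda$ is unbounded on $\ell^p(\mathbb Z^d)$: there is no finite constant $C$ such that $\|M_\Lambda f\|_{\ell^p(\mathbb Z^d)}\le C\|f\|_{\ell^p(\mathbb Z^d)}$ for all $f\in\ell^p(\mathbb Z^d)$. -/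

import Mathlib

open Filter Topology
open scoped ENNReal NNReal

noncomputable section

namespace ArithSphere

/-- The lattice points `y ∈ ℤ^d` with `|y|² = n`. -/
def sphere (d n : ℕ) : Set (Fin d → ℤ) :=
  {y | ∑ i, y i ^ 2 = (n : ℤ)}

theorem sphere_finite (d n : ℕ) : (sphere d n).Finite := by
  refine (Set.finite_Icc (fun _ : Fin d => -(n : ℤ)) (fun _ => (n : ℤ))).subset ?_
  intro y hy
  have hy' : ∑ i, y i ^ 2 = (n : ℤ) := hy
  have h : ∀ i, y i ^ 2 ≤ (n : ℤ) := fun i =>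
    hy' ▸ Finset.single_le_sum (fun j _ => sq_nonneg (y j)) (Finset.mem_univ i)
  refine ⟨fun i => ?_, fun i => ?_⟩
  · have := h i
    have h2 := Int.le_self_sq (-(y i))
    show -(n : ℤ) ≤ y i
    nlinarith
  · exact (Int.le_self_sq (y i)).trans (h i)

/-- The arithmetic spherical average
`A_n f(x) = #{y ∈ ℤ^d : |y|² = n}⁻¹ ∑_{|y|² = n} f(x - y)`. -/
def avg {d : ℕ} (n : ℕ) (f : (Fin d → ℤ) → ℂ) (x : Fin d → ℤ) : ℂ :=
  (∑ y ∈ (sphere_finite d n).toFinset, f (x - y)) / ((sphere d n).ncard : ℂ)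

/-- The arithmetic spherical maximal function `M_Λ f(x) = sup_{n ∈ Λ} |A_n f(x)|`,
as a function with values in `[0, ∞]`. -/
def maximalFn {d : ℕ} (Λ : Set ℕ) (f : (Fin d → ℤ) → ℂ) (x : Fin d → ℤ) : ℝ≥0∞ :=
  ⨆ n ∈ Λ, ‖avg n f x‖ₑ

/-- The `ℓ^p(ℤ^d)` norm of a `[0, ∞]`-valued function, for `0 < p < ∞`. -/
def ellNorm {d : ℕ} (p : ℝ) (g : (Fin d → ℤ) → ℝ≥0∞) : ℝ≥0∞ :=
  (∑' x, g x ^ p) ^ (1 / p)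

/-- `M_Λ` is bounded on `ℓ^p(ℤ^d)`: there is a finite `C` with
`‖M_Λ f‖_p ≤ C ‖f‖_p` for all `f ∈ ℓ^p(ℤ^d)`. -/
def IsBoundedMaximal (d : ℕ) (Λ : Set ℕ) (p : ℝ) : Prop :=
  ∃ C : ℝ≥0, ∀ f : (Fin d → ℤ) → ℂ, Memℓp f (ENNReal.ofReal p) →
    ellNorm p (maximalFn Λ f) ≤ C * ellNorm p (fun x => ‖f x‖ₑ)

/-- The `q`-adic upper Minkowski dimension of `Λ`, i.e. `limsup_{ε → 0+} log N(ε) / log (1/ε)`,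
where `N(ε)` is the least number of closed balls of radius `ε` (centred in `Λ`) that cover `Λ`
in `ℤ_q`. Since `ℤ_q` is compact, `N(ε)` is finite. The empty set gets dimension `0`. -/
def padicDim (q : ℕ) [Fact q.Prime] (Λ : Set ℕ) : ℝ :=
  limsup (fun ε : ℝ≥0 =>
    Real.log (Metric.coveringNumber ε ((fun n : ℕ => (n : ℤ_[q])) '' Λ)).toNat
      / Real.log (1 / (ε : ℝ))) (𝓝[>] 0)

/-- The infimum of the `δ ≥ 0` such that `#(Λ ∩ [N, 2N]) ≤ C N^δ` for all `N ≥ 1`,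
with `C` independent of `N`. -/
def growthExp (Λ : Set ℕ) : ℝ :=
  sInf {δ : ℝ | 0 ≤ δ ∧ ∃ C : ℝ, ∀ N : ℕ, 1 ≤ N →
    ((Λ ∩ Set.Icc N (2 * N)).ncard : ℝ) ≤ C * (N : ℝ) ^ δ}

/-- `η(Λ) = max { sup_q (1 + δ_q(Λ) / (d - 1)), 1 + 2 δ_∞(Λ) / (d - 2) }`. -/
def eta (d : ℕ) (Λ : Set ℕ) : ℝ :=
  max (⨆ q : Nat.Primes,
      (1 + (haveI : Fact (q : ℕ).Prime := ⟨q.2⟩; padicDim (q : ℕ) Λ) / ((d : ℝ) - 1)))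
    (1 + 2 * growthExp Λ / ((d : ℝ) - 2))

end ArithSphere

end

/-
Suppose `M_Λ` is bounded on `ℓ^p`; two families of test functions bound both dimensions.

* On a point mass, the averages of radii `n ∈ Λ` equal `1 / #sphere n` on disjoint spheres, so
  `∑ (#sphere n)^{1-p}` is bounded over `Λ`. With `#sphere n ≲ n^{d/2-1+ε}` this gives
  `δ_∞ ≤ (p-1)(d-2)/2`.
* On the indicator of a large piece of `Qℤ^d`, the average of radius `n` at `Qz + r` is the
  proportion of the sphere that reduces to `r` modulo `Q`. These proportions sum to `1` over the
  sphere modulo `Q`, and radii with different residues have disjoint reductions, so by Hölder's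
  inequality `Λ` has at most `≲ (max #(sphere mod Q))^{p-1}` residues modulo `Q`. With
  `#(sphere mod Q) ≲ Q^{d-1+ε}` and `Q = q^k` this gives `δ_q ≤ (p-1)(d-1)`.

Both counting bounds reduce, by slicing, to `d = 2`, where they are the divisor bound for Gaussian
integers.
-/

namespace ArithSphere

section DivisorBound

theorem exists_add_one_le_mul_pow {b : ℝ} (hb : 1 < b) :
    ∃ K : ℝ, 1 ≤ K ∧ ∀ a : ℕ, (a : ℝ) + 1 ≤ K * b ^ a := by
  have hb0 : 0 < b - 1 := sub_pos.2 hb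
  refine ⟨max 1 (b - 1)⁻¹, le_max_left _ _, fun a => ?_⟩
  calc (a : ℝ) + 1 = (b - 1)⁻¹ * (a * (b - 1)) + 1 * 1 := by field_simp
    _ ≤ max 1 (b - 1)⁻¹ * (a * (b - 1)) + max 1 (b - 1)⁻¹ * 1 := by
        gcongr
        exacts [le_max_right _ _, le_max_left _ _]
    _ = max 1 (b - 1)⁻¹ * (1 + a * (b - 1)) := by ring
    _ ≤ max 1 (b - 1)⁻¹ * b ^ a := by
        gcongr
        exact one_add_mul_sub_le_pow (by linarith) a

theorem exists_card_Iic_le_mul_prod_map {α : Type*} [DecidableEq α] {w : α → ℝ≥0} {b : ℝ≥0}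
    (hb : 1 < b) (hw : {x | w x < 2}.Finite) :
    ∃ K : ℝ≥0, ∀ s : Multiset α, (∀ x ∈ s, b ≤ w x) →
      ((Finset.Iic s).card : ℝ≥0) ≤ K * (s.map w).prod := by
  obtain ⟨K, hK1, hK⟩ := exists_add_one_le_mul_pow (b := b) (by exact_mod_cast hb)
  lift K to ℝ≥0 using by linarith
  norm_cast at hK1
  refine ⟨K ^ hw.toFinset.card, fun s hs => ?_⟩
  have hfactor : ∀ x ∈ s.toFinset,
      (s.count x : ℝ≥0) + 1 ≤ (if w x < 2 then K else 1) * w x ^ s.count x := by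
    intro x hx
    split_ifs with hx2
    · calc (s.count x : ℝ≥0) + 1 ≤ K * b ^ s.count x := mod_cast hK (s.count x)
        _ ≤ K * w x ^ s.count x := by gcongr; exact hs x (Multiset.mem_toFinset.1 hx)
    · calc (s.count x : ℝ≥0) + 1 ≤ 2 ^ s.count x := mod_cast Nat.lt_two_pow_self
        _ ≤ 1 * w x ^ s.count x := by rw [one_mul]; gcongr; exact not_lt.1 hx2
  have hsmall : ∏ x ∈ s.toFinset, (if w x < 2 then K else 1) ≤ K ^ hw.toFinset.card := by
    rw [← Finset.prod_filter, Finset.prod_const]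
    exact pow_le_pow_right₀ hK1 (Finset.card_le_card fun x hx => by simp_all)
  calc ((Finset.Iic s).card : ℝ≥0) = ∏ x ∈ s.toFinset, ((s.count x : ℝ≥0) + 1) := by
        rw [Multiset.card_Iic]; push_cast; rfl
    _ ≤ ∏ x ∈ s.toFinset, ((if w x < 2 then K else 1) * w x ^ s.count x) :=
        Finset.prod_le_prod' hfactor
    _ ≤ K ^ hw.toFinset.card * (s.map w).prod := by
        rw [Finset.prod_mul_distrib, Finset.prod_multiset_map_count]
        gcongr

theorem map_eq_of_associated {M : Type*} [Monoid M] [Finite Mˣ] (w : M →* ℝ≥0) {x y : M}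
    (h : Associated x y) : w x = w y := by
  obtain ⟨u, rfl⟩ := h
  have hu : w u = 1 := by
    obtain ⟨n, hn, hun⟩ := isOfFinOrder_iff_pow_eq_one.1 (isOfFinOrder_of_finite u)
    rw [← pow_eq_one_iff_of_nonneg zero_le hn.ne', ← map_pow, ← Units.val_pow_eq_pow_val, hun,
      Units.val_one, map_one]
  rw [map_mul, hu, mul_one]

open UniqueFactorizationMonoid

variable {M : Type*} [CommMonoidWithZero M] [UniqueFactorizationMonoid M] [Finite Mˣ]

theorem ncard_setOf_dvd_le [NormalizationMonoid M] [DecidableEq M] {m : M} (hm : m ≠ 0) :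
    {z | z ∣ m}.ncard ≤ Nat.card Mˣ * (Finset.Iic (normalizedFactors m)).card := by
  let S : Set (Mˣ × Multiset M) := Set.univ ×ˢ ↑(Finset.Iic (normalizedFactors m))
  have hS : S.Finite := Set.finite_univ.prod (Finset.finite_toSet _)
  have hsub : {z | z ∣ m} ⊆ (fun t : Mˣ × Multiset M => t.2.prod * t.1) '' S := by
    intro z hz
    have hz0 : z ≠ 0 := ne_zero_of_dvd_ne_zero hm hz
    obtain ⟨u, hu⟩ := prod_normalizedFactors hz0
    exact ⟨(u, normalizedFactors z),
      by simpa [S] using (dvd_iff_normalizedFactors_le_normalizedFactors hz0 hm).1 hz, hu⟩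
  calc {z | z ∣ m}.ncard ≤ S.ncard :=
        (Set.ncard_le_ncard hsub (hS.image _)).trans (Set.ncard_image_le hS)
    _ = _ := by rw [Set.ncard_prod, Set.ncard_univ, Set.ncard_coe_finset]

/- If a prime `π` divides `m` exactly `a` times, it has `a + 1` possible exponents in a divisor of
`m`. This is at most `2 ^ a ≤ w (π ^ a)` when `2 ≤ w π`, and only the finitely many other primes
cost a constant. -/
theorem exists_ncard_setOf_dvd_le (w : M →* ℝ≥0) {b : ℝ≥0} (hb : 1 < b)
    (hprime : ∀ x, Prime x → b ≤ w x) (hfin : {x | w x < 2}.Finite) :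
    ∃ K : ℝ≥0, ∀ m : M, m ≠ 0 → ({z | z ∣ m}.ncard : ℝ≥0) ≤ K * w m := by
  classical
  let _ : NormalizationMonoid M :=
    UniqueFactorizationMonoid.strongNormalizationMonoid.toNormalizationMonoid
  obtain ⟨K, hK⟩ := exists_card_Iic_le_mul_prod_map hb hfin
  refine ⟨Nat.card Mˣ * K, fun m hm => ?_⟩
  calc ({z | z ∣ m}.ncard : ℝ≥0)
      ≤ Nat.card Mˣ * (Finset.Iic (normalizedFactors m)).card :=
        mod_cast ncard_setOf_dvd_le hm
    _ ≤ Nat.card Mˣ * (K * ((normalizedFactors m).map w).prod) := by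
        gcongr
        exact hK _ fun x hx => hprime x (prime_of_normalized_factor x hx)
    _ = Nat.card Mˣ * K * w m := by
        rw [Multiset.prod_hom, map_eq_of_associated w (prod_normalizedFactors hm), mul_assoc]

end DivisorBound

section GaussianInt

theorem finite_setOf_gaussianInt_norm_le (b : ℤ) : {z : GaussianInt | z.norm ≤ b}.Finite := by
  have hbox : ((Set.Icc (-b) b ×ˢ Set.Icc (-b) b).image
      fun t : ℤ × ℤ => (⟨t.1, t.2⟩ : GaussianInt)).Finite :=
    ((Set.finite_Icc _ _).prod (Set.finite_Icc _ _)).image _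
  refine hbox.subset fun z (hz : z.norm ≤ b) => ⟨(z.re, z.im), ?_, rfl⟩
  have hsq : z.re ^ 2 + z.im ^ 2 ≤ b := by rw [Zsqrtd.norm_def] at hz; linarith
  have hre : |z.re| ≤ b := by
    linarith [Int.le_self_sq |z.re|, sq_abs z.re, sq_nonneg z.im]
  have him : |z.im| ≤ b := by
    linarith [Int.le_self_sq |z.im|, sq_abs z.im, sq_nonneg z.re]
  exact ⟨abs_le.1 hre, abs_le.1 him⟩

theorem finite_units_gaussianInt : Finite GaussianIntˣ := by
  refine Set.finite_univ_iff.1 (((finite_setOf_gaussianInt_norm_le 1).preimage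
    Units.val_injective.injOn).subset fun u _ => ?_)
  exact ((Zsqrtd.norm_eq_one_iff' (by norm_num) (u : GaussianInt)).2 u.isUnit).le

theorem two_le_natAbs_norm_of_prime {z : GaussianInt} (hz : Prime z) : 2 ≤ z.norm.natAbs := by
  have h0 : z.norm ≠ 0 := (GaussianInt.norm_pos.2 hz.ne_zero).ne'
  have h1 : z.norm.natAbs ≠ 1 := fun h => hz.not_isUnit (Zsqrtd.norm_eq_one_iff.1 h)
  omega

theorem exists_ncard_setOf_dvd_gaussianInt_le {ε : ℝ} (hε : 0 < ε) :
    ∃ K : ℝ≥0, ∀ m : GaussianInt, m ≠ 0 →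
      ({z | z ∣ m}.ncard : ℝ≥0) ≤ K * (m.norm.natAbs : ℝ≥0) ^ ε := by
  have := finite_units_gaussianInt
  let w : GaussianInt →* ℝ≥0 :=
    (NNReal.rpowMonoidHom ε).comp ((Nat.castRingHom ℝ≥0 : ℕ →* ℝ≥0).comp
      ((Int.natAbsHom : ℤ →* ℕ).comp Zsqrtd.normMonoidHom))
  refine exists_ncard_setOf_dvd_le w (b := 2 ^ ε) (NNReal.one_lt_rpow one_lt_two hε)
    (fun z hz => ?_) ?_
  · change (2 : ℝ≥0) ^ ε ≤ (z.norm.natAbs : ℝ≥0) ^ ε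
    gcongr
    exact_mod_cast two_le_natAbs_norm_of_prime hz
  · refine (finite_setOf_gaussianInt_norm_le ⌈(2 : ℝ≥0) ^ ε⁻¹⌉₊).subset fun z hz => ?_
    have hlt : (z.norm.natAbs : ℝ≥0) ^ ε < 2 := hz
    have hle : z.norm.natAbs ≤ ⌈(2 : ℝ≥0) ^ ε⁻¹⌉₊ := by
      exact_mod_cast ((NNReal.lt_rpow_inv_iff hε).2 hlt).le.trans (Nat.le_ceil _)
    exact Int.le_natAbs.trans (mod_cast hle)

end GaussianInt

section Sphere

variable {d n : ℕ}

theorem mem_sphere {y : Fin d → ℤ} : y ∈ sphere d n ↔ ∑ i, y i ^ 2 = (n : ℤ) := Iff.rfl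

/-- The cube of lattice points whose coordinates are at most `L` in absolute value; it bounds the
spheres and carries the test functions. -/
noncomputable def box (d L : ℕ) : Finset (Fin d → ℤ) :=
  Fintype.piFinset fun _ => Finset.Icc (-(L : ℤ)) L

theorem mem_box {L : ℕ} {y : Fin d → ℤ} : y ∈ box d L ↔ ∀ i, |y i| ≤ L := by
  simp only [box, Fintype.mem_piFinset, Finset.mem_Icc, abs_le]

theorem card_box (d L : ℕ) : (box d L).card = (2 * L + 1) ^ d := by
  rw [box, Fintype.card_piFinset_const, Int.card_Icc]
  congr 1
  omega

theorem mem_box_sqrt_of_mem_sphere {y : Fin d → ℤ} (hy : y ∈ sphere d n) :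
    y ∈ box d (Nat.sqrt n) := by
  refine mem_box.2 fun i => ?_
  have hi : y i ^ 2 ≤ n :=
    (mem_sphere.1 hy) ▸ Finset.single_le_sum (fun j _ => sq_nonneg (y j)) (Finset.mem_univ i)
  rw [Int.abs_eq_natAbs, Nat.cast_le, Nat.le_sqrt']
  zify
  simpa using hi

theorem sphere_nonempty (hd : 4 ≤ d) (n : ℕ) : (sphere d n).Nonempty := by
  obtain ⟨e, rfl⟩ := Nat.exists_eq_add_of_le' hd
  obtain ⟨a, b, c, k, h⟩ := Nat.sum_four_squares n
  refine ⟨Fin.cons a (Fin.cons b (Fin.cons c (Fin.cons k 0))), mem_sphere.2 ?_⟩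
  simp only [Fin.sum_univ_succ, Fin.cons_zero, Fin.cons_succ, Pi.zero_apply, ← h]
  push_cast
  simp
  ring

theorem sphere_zero (d : ℕ) : sphere d 0 = {0} := by
  ext y
  simp [mem_sphere, Finset.sum_eq_zero_iff_of_nonneg, sq_nonneg, funext_iff]

theorem pairwise_disjoint_sphere (d : ℕ) : Pairwise (Function.onFun Disjoint (sphere d)) :=
  fun _ _ hmn => Set.disjoint_left.2 fun _ hy hy' => hmn (by exact_mod_cast hy.symm.trans hy')

/- If `n = |z|²` for a Gaussian integer `z`, then `z` divides `n`. -/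
theorem ncard_sphere_two_le_ncard_setOf_dvd (hn : n ≠ 0) :
    (sphere 2 n).ncard ≤ {z : GaussianInt | z ∣ n}.ncard := by
  have hfin : {z : GaussianInt | z ∣ n}.Finite := by
    have := finite_units_gaussianInt
    have := Fintype.ofFinite GaussianIntˣ
    have := UniqueFactorizationMonoid.fintypeSubtypeDvd (n : GaussianInt) (mod_cast hn)
    exact Set.finite_coe_iff.1 (Finite.of_fintype {z // z ∣ (n : GaussianInt)})
  refine Set.ncard_le_ncard_of_injOn (fun y => (⟨y 0, y 1⟩ : GaussianInt)) ?_ ?_ hfin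
  · intro y hy
    rw [mem_sphere, Fin.sum_univ_two] at hy
    refine ⟨star ⟨y 0, y 1⟩, ?_⟩
    rw [← Zsqrtd.norm_eq_mul_conj, Zsqrtd.norm_def, ← Int.cast_natCast, ← hy]
    congr 1
    ring
  · intro y _ y' _ h
    simpa [Zsqrtd.ext_iff, funext_iff, Fin.forall_fin_two] using h

theorem exists_ncard_sphere_two_le {ε : ℝ} (hε : 0 < ε) :
    ∃ C : ℝ≥0, ∀ n : ℕ, ((sphere 2 n).ncard : ℝ) ≤ C * ((n : ℝ) + 1) ^ ε := by
  obtain ⟨K, hK⟩ := exists_ncard_setOf_dvd_gaussianInt_le (half_pos hε)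
  refine ⟨max 1 K, fun n => ?_⟩
  rcases eq_or_ne n 0 with rfl | hn
  · simp [sphere_zero]
  have hnorm : ((n : GaussianInt).norm.natAbs : ℝ) ^ (ε / 2) = (n : ℝ) ^ ε := by
    rw [Zsqrtd.norm_natCast, Int.natAbs_mul, Int.natAbs_natCast, ← sq, Nat.cast_pow,
      ← Real.rpow_natCast, ← Real.rpow_mul n.cast_nonneg]
    congr 1
    push_cast
    ring
  calc ((sphere 2 n).ncard : ℝ) ≤ {z : GaussianInt | z ∣ n}.ncard :=
        mod_cast ncard_sphere_two_le_ncard_setOf_dvd hn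
    _ ≤ K * ((n : GaussianInt).norm.natAbs : ℝ) ^ (ε / 2) := mod_cast hK n (mod_cast hn)
    _ = K * (n : ℝ) ^ ε := by rw [hnorm]
    _ ≤ (max 1 K : ℝ≥0) * ((n : ℝ) + 1) ^ ε := by
        gcongr
        · exact le_max_right _ _
        · linarith

theorem ncard_setOf_mem_sphere_succ_le {K : ℝ}
    (hK : ∀ m ≤ n, ((sphere d m).ncard : ℝ) ≤ K) (a : ℤ) :
    ({y ∈ sphere (d + 1) n | y 0 = a}.ncard : ℝ) ≤ K := by
  have htail : ∀ y ∈ {y ∈ sphere (d + 1) n | y 0 = a},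
      Fin.tail y ∈ sphere d ((n : ℤ) - a ^ 2).toNat ∧ ((n : ℤ) - a ^ 2).toNat ≤ n := by
    rintro y ⟨hy, rfl⟩
    rw [mem_sphere, Fin.sum_univ_succ] at hy
    have hnonneg : 0 ≤ ∑ i : Fin d, y i.succ ^ 2 := Finset.sum_nonneg fun i _ => sq_nonneg _
    have hsq := sq_nonneg (y 0)
    refine ⟨mem_sphere.2 ?_, by omega⟩
    simp only [Fin.tail]
    omega
  rcases Set.eq_empty_or_nonempty {y ∈ sphere (d + 1) n | y 0 = a} with hempty | ⟨y, hy⟩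
  · rw [hempty, Set.ncard_empty, Nat.cast_zero]
    exact (Nat.cast_nonneg _).trans (hK n le_rfl)
  · refine le_trans ?_ (hK _ (htail y hy).2)
    refine mod_cast Set.ncard_le_ncard_of_injOn Fin.tail (fun y hy => (htail y hy).1) ?_
      (sphere_finite _ _)
    intro y hy z hz hyz
    rw [← Fin.cons_self_tail y, ← Fin.cons_self_tail z, hyz, hy.2, hz.2]

theorem ncard_sphere_succ_le {K : ℝ} (hK : ∀ m ≤ n, ((sphere d m).ncard : ℝ) ≤ K) :
    ((sphere (d + 1) n).ncard : ℝ) ≤ (2 * Nat.sqrt n + 1) * K := by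
  let I : Finset ℤ := Finset.Icc (-(Nat.sqrt n : ℤ)) (Nat.sqrt n)
  have hcover : sphere (d + 1) n ⊆ ⋃ a ∈ I, {y ∈ sphere (d + 1) n | y 0 = a} := by
    intro y hy
    have h0 := mem_box.1 (mem_box_sqrt_of_mem_sphere hy) 0
    exact Set.mem_biUnion (Finset.mem_coe.2 (Finset.mem_Icc.2 (abs_le.1 h0))) ⟨hy, rfl⟩
  have hfin : (⋃ a ∈ I, {y ∈ sphere (d + 1) n | y 0 = a}).Finite :=
    (sphere_finite (d + 1) n).subset (Set.iUnion₂_subset fun _ _ => Set.sep_subset _ _)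
  calc ((sphere (d + 1) n).ncard : ℝ)
      ≤ ∑ a ∈ I, ({y ∈ sphere (d + 1) n | y 0 = a}.ncard : ℝ) := by
        exact_mod_cast (Set.ncard_le_ncard hcover hfin).trans (Finset.set_ncard_biUnion_le _ _)
    _ ≤ I.card • K := Finset.sum_le_card_nsmul _ _ _ fun a _ => ncard_setOf_mem_sphere_succ_le hK a
    _ = (2 * Nat.sqrt n + 1) * K := by
        rw [nsmul_eq_mul, Int.card_Icc, show ((Nat.sqrt n : ℤ) + 1 - -(Nat.sqrt n : ℤ)).toNat =
          2 * Nat.sqrt n + 1 by omega]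
        push_cast
        rfl

theorem exists_ncard_sphere_le (hd : 2 ≤ d) {ε : ℝ} (hε : 0 < ε) :
    ∃ C : ℝ≥0, ∀ n : ℕ, ((sphere d n).ncard : ℝ) ≤ C * ((n : ℝ) + 1) ^ ((d : ℝ) / 2 - 1 + ε) := by
  induction d, hd using Nat.le_induction with
  | base => simpa using exists_ncard_sphere_two_le hε
  | succ d hd ih =>
    obtain ⟨C, hC⟩ := ih
    have hd' : (2 : ℝ) ≤ d := by exact_mod_cast hd
    refine ⟨3 * C, fun n => ?_⟩
    have hn1 : (1 : ℝ) ≤ (n : ℝ) + 1 := by simp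
    have hslices : ∀ m ≤ n,
        ((sphere d m).ncard : ℝ) ≤ C * ((n : ℝ) + 1) ^ ((d : ℝ) / 2 - 1 + ε) := fun m hm =>
      (hC m).trans (by gcongr; linarith)
    have hsqrt : 2 * (Nat.sqrt n : ℝ) + 1 ≤ 3 * ((n : ℝ) + 1) ^ (1 / 2 : ℝ) := by
      rw [← Real.sqrt_eq_rpow]
      have h1 : (Nat.sqrt n : ℝ) ≤ √((n : ℝ) + 1) :=
        Real.nat_sqrt_le_real_sqrt.trans (Real.sqrt_le_sqrt (by linarith))
      have h2 : 1 ≤ √((n : ℝ) + 1) := Real.one_le_sqrt.2 hn1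
      linarith
    calc ((sphere (d + 1) n).ncard : ℝ)
        ≤ (2 * Nat.sqrt n + 1) * (C * ((n : ℝ) + 1) ^ ((d : ℝ) / 2 - 1 + ε)) :=
          ncard_sphere_succ_le hslices
      _ ≤ 3 * ((n : ℝ) + 1) ^ (1 / 2 : ℝ) * (C * ((n : ℝ) + 1) ^ ((d : ℝ) / 2 - 1 + ε)) := by
          gcongr
      _ = 3 * C * (((n : ℝ) + 1) ^ (1 / 2 : ℝ) * ((n : ℝ) + 1) ^ ((d : ℝ) / 2 - 1 + ε)) := by ring
      _ = _ := by
          rw [← Real.rpow_add (by positivity)]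
          push_cast
          congr 2
          ring

end Sphere

section SphereMod

/-- The sphere `r₁² + ⋯ + r_d² = l` over `ℤ / Qℤ`, which contains the reductions mod `Q` of the
points of `sphere d n` for all `n ≡ l` mod `Q`. -/
def sphereMod (d Q : ℕ) [NeZero Q] (l : ZMod Q) : Finset (Fin d → ZMod Q) :=
  {r | ∑ i, r i ^ 2 = l}

variable {d Q : ℕ} [NeZero Q]

theorem mem_sphereMod {l : ZMod Q} {r : Fin d → ZMod Q} :
    r ∈ sphereMod d Q l ↔ ∑ i, r i ^ 2 = l := by
  simp [sphereMod]

/- The representatives `0 ≤ r i < Q` have square sum congruent to `l` and less than `d * Q ^ 2`. -/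
theorem card_sphereMod_le_sum (hd : 0 < d) (l : ZMod Q) :
    (sphereMod d Q l).card ≤ ∑ j ∈ Finset.range (d * Q), (sphere d (l.val + Q * j)).ncard := by
  classical
  let S : ℕ → Finset (Fin d → ℤ) := fun j => (sphere_finite d (l.val + Q * j)).toFinset
  have hS : (sphereMod d Q l).card ≤ ((Finset.range (d * Q)).biUnion S).card := by
    refine Finset.card_le_card_of_injOn (fun r i => ((r i).val : ℤ)) (fun r hr => ?_) ?_
    · let v := ∑ i, (r i).val ^ 2
      have hmod : v % Q = l.val := by
        rw [← mem_sphereMod.1 hr, ← ZMod.val_natCast]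
        simp [v]
      have hlt : v < d * Q * Q := by
        have : Nonempty (Fin d) := ⟨⟨0, hd⟩⟩
        calc v < ∑ _i : Fin d, Q ^ 2 := Finset.sum_lt_sum_of_nonempty Finset.univ_nonempty
              fun i _ => Nat.pow_lt_pow_left (ZMod.val_lt _) two_ne_zero
          _ = d * Q * Q := by simp [sq, mul_assoc]
      refine Finset.mem_biUnion.2
        ⟨v / Q, Finset.mem_range.2 (Nat.div_lt_of_lt_mul (by linarith)), ?_⟩
      rw [Set.Finite.mem_toFinset, mem_sphere, ← hmod, Nat.mod_add_div]
      simp [v]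
    · exact fun r _ r' _ h => funext fun i =>
        ZMod.val_injective Q (Int.ofNat_inj.1 (congrFun h i))
  calc (sphereMod d Q l).card ≤ ∑ j ∈ Finset.range (d * Q), (S j).card :=
        hS.trans Finset.card_biUnion_le
    _ = _ := Finset.sum_congr rfl fun j _ => (Set.ncard_eq_toFinset_card _ _).symm

theorem exists_card_sphereMod_le (hd : 2 ≤ d) {ε : ℝ} (hε : 0 < ε) :
    ∃ C : ℝ≥0, ∀ (Q : ℕ) [NeZero Q] (l : ZMod Q),
      ((sphereMod d Q l).card : ℝ) ≤ C * (Q : ℝ) ^ ((d : ℝ) - 1 + ε) := by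
  obtain ⟨C, hC⟩ := exists_ncard_sphere_le hd (half_pos hε)
  have hd' : (2 : ℝ) ≤ d := by exact_mod_cast hd
  set a : ℝ := (d : ℝ) / 2 - 1 + ε / 2 with ha
  have ha0 : 0 ≤ a := by linarith
  refine ⟨d * C * d ^ a, fun Q _ l => ?_⟩
  have hQ : (0 : ℝ) < Q := by exact_mod_cast NeZero.pos Q
  have hterm : ∀ j ∈ Finset.range (d * Q),
      ((sphere d (l.val + Q * j)).ncard : ℝ) ≤ C * (d * (Q : ℝ) ^ 2) ^ a := by
    intro j hj
    have hlt : l.val + Q * j + 1 ≤ d * Q ^ 2 :=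
      calc l.val + Q * j + 1 ≤ Q + Q * j := by linarith [ZMod.val_lt l]
        _ = Q * (j + 1) := by ring
        _ ≤ Q * (d * Q) := by gcongr; exact Finset.mem_range.1 hj
        _ = d * Q ^ 2 := by ring
    refine (hC _).trans ?_
    gcongr
    exact_mod_cast hlt
  calc ((sphereMod d Q l).card : ℝ)
      ≤ ∑ j ∈ Finset.range (d * Q), ((sphere d (l.val + Q * j)).ncard : ℝ) := by
        exact_mod_cast card_sphereMod_le_sum (by omega) l
    _ ≤ d * Q * (C * (d * (Q : ℝ) ^ 2) ^ a) := by
        simpa using Finset.sum_le_card_nsmul _ _ _ hterm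
    _ = d * C * d ^ a * ((Q : ℝ) * (Q ^ 2) ^ a) := by
        rw [Real.mul_rpow (by positivity) (by positivity)]
        ring
    _ = (d * C * d ^ a : ℝ≥0) * (Q : ℝ) ^ ((d : ℝ) - 1 + ε) := by
        rw [← Real.rpow_natCast_mul hQ.le, ← Real.rpow_one_add' hQ.le (by positivity)]
        push_cast
        congr 2
        rw [ha]
        ring

end SphereMod

section Testing

variable {d : ℕ} {Λ : Set ℕ} {p : ℝ}

/-- The proportion of the points of `sphere d n` that lie in `S`; it is `0` by convention when the
sphere is empty. Averages of indicator functions are such proportions. -/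
noncomputable def sphereDensity (n : ℕ) (S : Set (Fin d → ℤ)) : ℝ :=
  (sphere d n ∩ S).ncard / (sphere d n).ncard

theorem sphereDensity_nonneg (n : ℕ) (S : Set (Fin d → ℤ)) : 0 ≤ sphereDensity n S := by
  unfold sphereDensity
  positivity

theorem sphereDensity_le_of_subset {n : ℕ} {S S' : Set (Fin d → ℤ)}
    (h : sphere d n ∩ S ⊆ S') : sphereDensity n S ≤ sphereDensity n S' := by
  unfold sphereDensity
  have hle : (sphere d n ∩ S).ncard ≤ (sphere d n ∩ S').ncard :=
    Set.ncard_le_ncard (Set.subset_inter Set.inter_subset_left h)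
      ((sphere_finite d n).subset Set.inter_subset_left)
  gcongr

theorem avg_indicator_one (n : ℕ) (T : Set (Fin d → ℤ)) (x : Fin d → ℤ) :
    avg n (T.indicator 1) x = (sphereDensity n {y | x - y ∈ T} : ℝ) := by
  classical
  have hcount : ∑ y ∈ (sphere_finite d n).toFinset, T.indicator (1 : (Fin d → ℤ) → ℂ) (x - y) =
      (sphere d n ∩ {y | x - y ∈ T}).ncard := by
    simp only [Set.indicator_apply, Pi.one_apply, Finset.sum_boole]
    rw [← Set.ncard_coe_finset, Finset.coe_filter]
    simp only [Set.Finite.mem_toFinset]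
    rfl
  rw [avg, hcount, sphereDensity]
  push_cast
  rfl

theorem ofReal_sphereDensity_le_maximalFn {n : ℕ} (hn : n ∈ Λ) (T : Set (Fin d → ℤ))
    (x : Fin d → ℤ) :
    ENNReal.ofReal (sphereDensity n {y | x - y ∈ T}) ≤ maximalFn Λ (T.indicator 1) x := by
  refine le_trans (le_of_eq ?_) (le_iSup₂ (f := fun n (_ : n ∈ Λ) => ‖avg n _ x‖ₑ) n hn)
  rw [avg_indicator_one, ← ofReal_norm, Complex.norm_real,
    Real.norm_of_nonneg (sphereDensity_nonneg _ _)]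

theorem memℓp_indicator_one (hp : 0 < p) (T : Finset (Fin d → ℤ)) :
    Memℓp ((T : Set (Fin d → ℤ)).indicator (1 : (Fin d → ℤ) → ℂ)) (ENNReal.ofReal p) := by
  refine memℓp_gen ?_
  rw [ENNReal.toReal_ofReal hp.le]
  exact summable_of_ne_finset_zero (s := T) fun x hx => by simp [hx, hp.ne']

theorem ellNorm_rpow (hp : 0 < p) (g : (Fin d → ℤ) → ℝ≥0∞) :
    ellNorm p g ^ p = ∑' x, g x ^ p := by
  rw [ellNorm, ← ENNReal.rpow_mul, one_div_mul_cancel hp.ne', ENNReal.rpow_one]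

theorem ellNorm_indicator_one_rpow (hp : 0 < p) (T : Finset (Fin d → ℤ)) :
    ellNorm p (fun x => ‖(T : Set (Fin d → ℤ)).indicator (1 : (Fin d → ℤ) → ℂ) x‖ₑ) ^ p =
      T.card := by
  rw [ellNorm_rpow hp, tsum_eq_sum (s := T) fun x hx => by simp [hx, hp],
    Finset.sum_congr rfl (g := fun _ => 1) fun x hx => by simp [hx]]
  simp

theorem IsBoundedMaximal.exists_tsum_maximalFn_indicator_one_rpow_le
    (hp : 0 < p) (h : IsBoundedMaximal d Λ p) :
    ∃ C : ℝ≥0, ∀ T : Finset (Fin d → ℤ),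
      ∑' x, maximalFn Λ ((T : Set (Fin d → ℤ)).indicator 1) x ^ p ≤ C * T.card := by
  obtain ⟨C, hC⟩ := h
  refine ⟨C ^ p, fun T => ?_⟩
  rw [← ellNorm_rpow hp, ← ellNorm_indicator_one_rpow hp, ENNReal.coe_rpow_of_nonneg _ hp.le,
    ← ENNReal.mul_rpow_of_nonneg _ _ hp.le]
  exact ENNReal.rpow_le_rpow (hC _ (memℓp_indicator_one hp T)) hp.le

theorem IsBoundedMaximal.exists_sum_sphereDensity_rpow_le (hp : 0 < p)
    (h : IsBoundedMaximal d Λ p) :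
    ∃ C : ℝ≥0, ∀ (T : Finset (Fin d → ℤ)) {ι : Type*} (I : Finset ι) (n : ι → ℕ)
      (x : ι → Fin d → ℤ), (∀ i ∈ I, n i ∈ Λ) → Set.InjOn x I →
        ∑ i ∈ I, sphereDensity (n i) {y | x i - y ∈ T} ^ p ≤ C * T.card := by
  classical
  obtain ⟨C, hC⟩ := h.exists_tsum_maximalFn_indicator_one_rpow_le hp
  refine ⟨C, fun T ι I n x hn hx => ?_⟩
  let M : (Fin d → ℤ) → ℝ≥0∞ := maximalFn Λ ((T : Set (Fin d → ℤ)).indicator 1)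
  have hnonneg : ∀ i, 0 ≤ sphereDensity (n i) {y | x i - y ∈ T} := fun i =>
    sphereDensity_nonneg (n i) _
  rw [← ENNReal.ofReal_le_ofReal_iff (by positivity)]
  calc ENNReal.ofReal (∑ i ∈ I, sphereDensity (n i) {y | x i - y ∈ T} ^ p)
      = ∑ i ∈ I, ENNReal.ofReal (sphereDensity (n i) {y | x i - y ∈ T}) ^ p := by
        rw [ENNReal.ofReal_sum_of_nonneg fun i _ => Real.rpow_nonneg (hnonneg i) p]
        simp only [ENNReal.ofReal_rpow_of_nonneg (hnonneg _) hp.le]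
    _ ≤ ∑ i ∈ I, M (x i) ^ p := by
        gcongr with i hi
        simpa only [Finset.mem_coe] using ofReal_sphereDensity_le_maximalFn (hn i hi) ↑T (x i)
    _ = ∑ z ∈ I.image x, M z ^ p := by rw [Finset.sum_image hx]
    _ ≤ ∑' z, M z ^ p := ENNReal.sum_le_tsum _
    _ ≤ C * T.card := hC T
    _ = ENNReal.ofReal (C * T.card) := by
        rw [ENNReal.ofReal_mul C.coe_nonneg, ENNReal.ofReal_coe_nnreal, ENNReal.ofReal_natCast]

theorem sphereDensity_setOf_sub_mem_singleton_zero {n : ℕ} {x : Fin d → ℤ}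
    (hx : x ∈ sphere d n) :
    sphereDensity n {y | x - y ∈ ({0} : Finset (Fin d → ℤ))} = ((sphere d n).ncard : ℝ)⁻¹ := by
  have hsingle : sphere d n ∩ {y | x - y ∈ ({0} : Finset (Fin d → ℤ))} = {x} := by
    ext y
    simp only [Finset.mem_singleton, sub_eq_zero, Set.mem_inter_iff, Set.mem_ofPred_eq,
      Set.mem_singleton_iff]
    exact ⟨fun hy => hy.2.symm, by rintro rfl; exact ⟨hx, rfl⟩⟩
  rw [sphereDensity, hsingle, Set.ncard_singleton, Nat.cast_one, one_div]

theorem IsBoundedMaximal.exists_sum_ncard_sphere_rpow_le (hp : 0 < p)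
    (hΛ : ∀ n ∈ Λ, (sphere d n).Nonempty) (h : IsBoundedMaximal d Λ p) :
    ∃ C : ℝ≥0, ∀ F : Finset ℕ, (F : Set ℕ) ⊆ Λ →
      ∑ n ∈ F, ((sphere d n).ncard : ℝ) ^ (1 - p) ≤ C := by
  obtain ⟨C, hC⟩ := h.exists_sum_sphereDensity_rpow_le hp
  refine ⟨C, fun F hF => ?_⟩
  let S : ℕ → Finset (Fin d → ℤ) := fun n => (sphere_finite d n).toFinset
  have hmem : ∀ t ∈ F.sigma S, t.1 ∈ F ∧ t.2 ∈ sphere d t.1 := fun t ht => by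
    simpa [S] using ht
  have hinj : Set.InjOn (fun t : Σ _ : ℕ, (Fin d → ℤ) => t.2) (F.sigma S) := by
    rintro ⟨n, y⟩ hy ⟨m, z⟩ hz (rfl : y = z)
    have hnm : n = m := by
      by_contra hnm
      exact Set.disjoint_left.1 (pairwise_disjoint_sphere d hnm) (hmem _ hy).2 (hmem _ hz).2
    rw [hnm]
  calc ∑ n ∈ F, ((sphere d n).ncard : ℝ) ^ (1 - p)
      = ∑ n ∈ F, ∑ y ∈ S n,
          sphereDensity n {z | y - z ∈ ({0} : Finset (Fin d → ℤ))} ^ p := by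
        refine Finset.sum_congr rfl fun n hn => ?_
        have hpos : (0 : ℝ) < (sphere d n).ncard := by
          exact_mod_cast (Set.ncard_pos (sphere_finite d n)).2 (hΛ n (hF hn))
        rw [Finset.sum_congr rfl fun y hy => by
            rw [sphereDensity_setOf_sub_mem_singleton_zero ((sphere_finite d n).mem_toFinset.1 hy)],
          Finset.sum_const,
          ← Set.ncard_eq_toFinset_card _ (sphere_finite d n), nsmul_eq_mul, Real.inv_rpow hpos.le,
          Real.rpow_sub hpos, Real.rpow_one, div_eq_mul_inv]
    _ = ∑ t ∈ F.sigma S, sphereDensity t.1 {z | t.2 - z ∈ ({0} : Finset (Fin d → ℤ))} ^ p :=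
        Finset.sum_sigma' ..
    _ ≤ C * ({0} : Finset (Fin d → ℤ)).card :=
        hC {0} _ _ _ (fun t ht => hF (hmem t ht).1) hinj
    _ = C := by simp

theorem IsBoundedMaximal.exists_card_le_of_ncard_sphere_le (hp : 1 ≤ p)
    (hΛ : ∀ n ∈ Λ, (sphere d n).Nonempty) (h : IsBoundedMaximal d Λ p) :
    ∃ C : ℝ≥0, ∀ (F : Finset ℕ) (K : ℝ), (F : Set ℕ) ⊆ Λ → 0 ≤ K →
      (∀ n ∈ F, ((sphere d n).ncard : ℝ) ≤ K) → (F.card : ℝ) ≤ C * K ^ (p - 1) := by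
  obtain ⟨C, hC⟩ := h.exists_sum_ncard_sphere_rpow_le (by linarith) hΛ
  refine ⟨C, fun F K hF hK0 hK => ?_⟩
  have hone : ∀ n ∈ F, 1 ≤ ((sphere d n).ncard : ℝ) ^ (1 - p) * K ^ (p - 1) := by
    intro n hn
    have hpos : (0 : ℝ) < (sphere d n).ncard := by
      exact_mod_cast (Set.ncard_pos (sphere_finite d n)).2 (hΛ n (hF hn))
    calc (1 : ℝ) = ((sphere d n).ncard : ℝ) ^ (1 - p) * ((sphere d n).ncard : ℝ) ^ (p - 1) := by
          rw [← Real.rpow_add hpos]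
          simp
      _ ≤ ((sphere d n).ncard : ℝ) ^ (1 - p) * K ^ (p - 1) := by
          gcongr
          exact hK n hn
  calc (F.card : ℝ) = ∑ n ∈ F, 1 := by simp
    _ ≤ ∑ n ∈ F, ((sphere d n).ncard : ℝ) ^ (1 - p) * K ^ (p - 1) := Finset.sum_le_sum hone
    _ ≤ C * K ^ (p - 1) := by
        rw [← Finset.sum_mul]
        gcongr
        exact hC F hF

end Testing

section Transference

variable {d Q : ℕ} {Λ : Set ℕ} {p : ℝ}

/-- The lattice points that reduce to `r` modulo `Q`. -/
def residueClass (r : Fin d → ZMod Q) : Set (Fin d → ℤ) :=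
  {y | ∀ i, (y i : ZMod Q) = r i}

theorem sum_sphereDensity_residueClass [NeZero Q] {n : ℕ} (hn : (sphere d n).Nonempty) :
    ∑ r ∈ sphereMod d Q n, sphereDensity n (residueClass r) = 1 := by
  classical
  have hmaps : ∀ y ∈ (sphere_finite d n).toFinset,
      (fun i => (y i : ZMod Q)) ∈ sphereMod d Q n := fun y hy => by
    have hsum : ∑ i, y i ^ 2 = (n : ℤ) := (sphere_finite d n).mem_toFinset.1 hy
    exact mem_sphereMod.2 (by exact_mod_cast congrArg (Int.cast : ℤ → ZMod Q) hsum)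
  have hfiber : ∀ r : Fin d → ZMod Q, (sphere d n ∩ residueClass r).ncard =
      {y ∈ (sphere_finite d n).toFinset | (fun i => (y i : ZMod Q)) = r}.card := fun r => by
    rw [← Set.ncard_coe_finset, Finset.coe_filter]
    simp only [Set.Finite.mem_toFinset, funext_iff]
    rfl
  have hcard : ((sphere d n).ncard : ℝ) ≠ 0 := by
    exact_mod_cast ((Set.ncard_pos (sphere_finite d n)).2 hn).ne'
  simp only [sphereDensity]
  rw [← Finset.sum_div, ← Nat.cast_sum, Finset.sum_congr rfl fun r _ => hfiber r,
    ← Finset.card_eq_sum_card_fiberwise hmaps, ← Set.ncard_eq_toFinset_card _ (sphere_finite d n),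
    div_self hcard]

/-- The translate of the residue vector `r`, taken in `[0, Q) ^ d`, by the lattice vector `Q z`. -/
def liftPoint (z : Fin d → ℤ) (r : Fin d → ZMod Q) : Fin d → ℤ :=
  fun i => Q * z i + (r i).val

theorem liftPoint_injective [NeZero Q] : Function.Injective2 (liftPoint (d := d) (Q := Q)) := by
  intro z z' r r' heq
  have hr : r = r' := funext fun i => by
    simpa [liftPoint] using congrArg (Int.cast : ℤ → ZMod Q) (congrFun heq i)
  subst hr
  have hQ : (Q : ℤ) ≠ 0 := by exact_mod_cast NeZero.ne Q
  exact ⟨funext fun i => mul_left_cancel₀ hQ (by simpa [liftPoint] using congrFun heq i), rfl⟩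

/- `Q z + r - y = Q (z - ⌊y / Q⌋)` for `y` congruent to `r`. -/
theorem liftPoint_sub_mem_image_box [NeZero Q] [DecidableEq (Fin d → ℤ)] {L : ℕ} {z y : Fin d → ℤ}
    {r : Fin d → ZMod Q} (hz : z ∈ box d L) (hy : y ∈ box d L) (hyr : y ∈ residueClass r) :
    liftPoint z r - y ∈ (box d (2 * L)).image ((Q : ℤ) • ·) := by
  refine Finset.mem_image.2 ⟨fun i => z i - y i / Q, mem_box.2 fun i => ?_, funext fun i => ?_⟩
  · have hdiv : |y i / (Q : ℤ)| ≤ L := by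
      obtain ⟨hlo, hhi⟩ := abs_le.1 (mem_box.1 hy i)
      have hQ : (1 : ℤ) ≤ Q := by exact_mod_cast NeZero.one_le
      refine abs_le.2 ⟨(Int.le_ediv_iff_mul_le (by omega)).2 (by nlinarith), ?_⟩
      exact (Int.ediv_le_ediv (by omega) hhi).trans (Int.ediv_le_self _ (by omega))
    calc |z i - y i / Q| ≤ |z i| + |y i / (Q : ℤ)| := abs_sub _ _
      _ ≤ L + L := add_le_add (mem_box.1 hz i) hdiv
      _ = (2 * L : ℕ) := by push_cast; ring
  · have hmod : ((r i).val : ℤ) = y i % Q := by rw [← hyr i, ZMod.val_intCast]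
    simp only [liftPoint, Pi.smul_apply, Pi.sub_apply, smul_eq_mul, hmod]
    linarith [Int.emod_add_mul_ediv (y i) Q]

theorem card_image_box_le [DecidableEq (Fin d → ℤ)] (f : (Fin d → ℤ) → Fin d → ℤ) (L : ℕ) :
    ((box d (2 * L)).image f).card ≤ 2 ^ d * (box d L).card := by
  refine Finset.card_image_le.trans ?_
  rw [card_box, card_box, ← mul_pow]
  exact Nat.pow_le_pow_left (by omega) d

theorem IsBoundedMaximal.exists_sum_sphereDensity_residueClass_rpow_le
    (hp : 0 < p) (h : IsBoundedMaximal d Λ p) :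
    ∃ C : ℝ≥0, ∀ (Q : ℕ) [NeZero Q] {ι : Type*} (I : Finset ι) (n : ι → ℕ)
      (r : ι → Fin d → ZMod Q), (∀ i ∈ I, n i ∈ Λ) → Set.InjOn r I →
        ∑ i ∈ I, sphereDensity (n i) (residueClass (r i)) ^ p ≤ C := by
  classical
  obtain ⟨C, hC⟩ := h.exists_sum_sphereDensity_rpow_le hp
  refine ⟨C * 2 ^ d, fun Q _ ι I n r hn hr => ?_⟩
  let L : ℕ := I.sup fun i => Nat.sqrt (n i)
  let T : Finset (Fin d → ℤ) := (box d (2 * L)).image ((Q : ℤ) • ·)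
  have hsphere : ∀ i ∈ I, sphere d (n i) ⊆ box d L := by
    intro i hi y hy
    refine mem_box.2 fun k => (mem_box.1 (mem_box_sqrt_of_mem_sphere hy) k).trans ?_
    exact_mod_cast Finset.le_sup (f := fun i => Nat.sqrt (n i)) hi
  have hdensity : ∀ t ∈ box d L ×ˢ I, sphereDensity (n t.2) (residueClass (r t.2)) ≤
      sphereDensity (n t.2) {y | liftPoint t.1 (r t.2) - y ∈ T} := fun t ht =>
    have ht := Finset.mem_product.1 ht
    sphereDensity_le_of_subset fun y hy =>
      liftPoint_sub_mem_image_box ht.1 (hsphere t.2 ht.2 hy.1) hy.2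
  have hinj : Set.InjOn (fun t : (Fin d → ℤ) × ι => liftPoint t.1 (r t.2)) (box d L ×ˢ I) := by
    rintro ⟨z, i⟩ hi ⟨z', i'⟩ hi' heq
    obtain ⟨hz, hri⟩ := liftPoint_injective heq
    exact Prod.ext hz (hr hi.2 hi'.2 hri)
  have hbox : (0 : ℝ) < (box d L).card := by rw [card_box]; positivity
  refine le_of_mul_le_mul_left ?_ hbox
  calc ((box d L).card : ℝ) * ∑ i ∈ I, sphereDensity (n i) (residueClass (r i)) ^ p
      = ∑ t ∈ box d L ×ˢ I, sphereDensity (n t.2) (residueClass (r t.2)) ^ p := by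
        simp only [Finset.sum_product, Finset.sum_const, nsmul_eq_mul]
    _ ≤ ∑ t ∈ box d L ×ˢ I, sphereDensity (n t.2) {y | liftPoint t.1 (r t.2) - y ∈ T} ^ p :=
        Finset.sum_le_sum fun t ht =>
          Real.rpow_le_rpow (sphereDensity_nonneg _ _) (hdensity t ht) hp.le
    _ ≤ C * T.card :=
        hC T _ _ _ (fun t ht => hn _ (Finset.mem_product.1 ht).2) (by simpa using hinj)
    _ ≤ C * (2 ^ d * (box d L).card : ℕ) := by gcongr; exact card_image_box_le _ L
    _ = (box d L).card * (C * 2 ^ d : ℝ≥0) := by push_cast; ring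

theorem one_le_mul_sum_sphereDensity_residueClass_rpow [NeZero Q] {n : ℕ} (hp : 1 ≤ p)
    (hn : (sphere d n).Nonempty) :
    1 ≤ ((sphereMod d Q n).card : ℝ) ^ (p - 1) *
      ∑ r ∈ sphereMod d Q n, sphereDensity n (residueClass r) ^ p := by
  simpa only [sum_sphereDensity_residueClass hn, Real.one_rpow] using
    Real.rpow_sum_le_const_mul_sum_rpow_of_nonneg (sphereMod d Q n) hp
      fun r _ => sphereDensity_nonneg n (residueClass r)

theorem IsBoundedMaximal.exists_card_le_of_card_sphereMod_le (hp : 1 ≤ p)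
    (hΛ : ∀ n ∈ Λ, (sphere d n).Nonempty) (h : IsBoundedMaximal d Λ p) :
    ∃ C : ℝ≥0, ∀ (Q : ℕ) [NeZero Q] (F : Finset ℕ) (K : ℝ), (F : Set ℕ) ⊆ Λ →
      Set.InjOn (Nat.cast : ℕ → ZMod Q) F → (∀ l : ZMod Q, ((sphereMod d Q l).card : ℝ) ≤ K) →
        (F.card : ℝ) ≤ C * K ^ (p - 1) := by
  obtain ⟨C, hC⟩ := h.exists_sum_sphereDensity_residueClass_rpow_le (by linarith)
  refine ⟨C, fun Q _ F K hF hFinj hK => ?_⟩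
  have hK0 : 0 ≤ K := (Nat.cast_nonneg _).trans (hK 0)
  have hinj : Set.InjOn (fun t : Σ _ : ℕ, (Fin d → ZMod Q) => t.2)
      (F.sigma fun n => sphereMod d Q n) := by
    rintro ⟨n, r⟩ hr ⟨m, s⟩ hs (rfl : r = s)
    rw [Finset.mem_coe, Finset.mem_sigma, mem_sphereMod] at hr hs
    have hnm : n = m := hFinj hr.1 hs.1 (hr.2.symm.trans hs.2)
    rw [hnm]
  calc (F.card : ℝ) = ∑ n ∈ F, 1 := by simp
    _ ≤ ∑ n ∈ F, K ^ (p - 1) *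
          ∑ r ∈ sphereMod d Q n, sphereDensity n (residueClass r) ^ p := by
        refine Finset.sum_le_sum fun n hn =>
          (one_le_mul_sum_sphereDensity_residueClass_rpow (Q := Q) hp (hΛ n (hF hn))).trans ?_
        refine mul_le_mul_of_nonneg_right
          (Real.rpow_le_rpow (Nat.cast_nonneg _) (hK n) (by linarith)) ?_
        exact Finset.sum_nonneg fun r _ => Real.rpow_nonneg (sphereDensity_nonneg _ _) p
    _ = K ^ (p - 1) * ∑ t ∈ F.sigma fun n => sphereMod d Q n,
          sphereDensity t.1 (residueClass t.2) ^ p := by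
        rw [← Finset.mul_sum, Finset.sum_sigma]
    _ ≤ K ^ (p - 1) * C := by
        gcongr
        exact hC Q _ _ _ (fun t ht => hF (Finset.mem_sigma.1 ht).1) hinj
    _ = C * K ^ (p - 1) := mul_comm _ _

end Transference

section Dimension

theorem le_mul_of_forall_pos_le_mul_add {x a b : ℝ} (h : ∀ ε : ℝ, 0 < ε → x ≤ b * (a + ε)) :
    x ≤ b * a := by
  have hlim : Tendsto (fun ε => b * (a + ε)) (𝓝[>] 0) (𝓝 (b * (a + 0))) :=
    ((continuous_const.mul (continuous_const.add continuous_id)).tendsto 0).mono_left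
      nhdsWithin_le_nhds
  rw [add_zero] at hlim
  exact ge_of_tendsto hlim (eventually_mem_nhdsWithin.mono h)

theorem IsBoundedMaximal.growthExp_le {d : ℕ} (hd : 2 ≤ d) {Λ : Set ℕ} {p : ℝ} (hp : 1 ≤ p)
    (hΛ : ∀ n ∈ Λ, (sphere d n).Nonempty) (h : IsBoundedMaximal d Λ p) :
    growthExp Λ ≤ (p - 1) * ((d : ℝ) / 2 - 1) := by
  have hp0 : 0 ≤ p - 1 := by linarith
  have hd' : (2 : ℝ) ≤ d := by exact_mod_cast hd
  refine le_mul_of_forall_pos_le_mul_add fun ε hε => ?_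
  set a : ℝ := (d : ℝ) / 2 - 1 + ε
  have ha : 0 ≤ a := by simp only [a]; linarith
  obtain ⟨C, hC⟩ := h.exists_card_le_of_ncard_sphere_le hp hΛ
  obtain ⟨D, hD⟩ := exists_ncard_sphere_le hd hε
  refine csInf_le ⟨0, fun δ hδ => hδ.1⟩
    ⟨mul_nonneg hp0 ha, C * (D * 3 ^ a) ^ (p - 1), fun N hN => ?_⟩
  have hN' : (1 : ℝ) ≤ N := by exact_mod_cast hN
  have hfin : (Λ ∩ Set.Icc N (2 * N)).Finite := (Set.finite_Icc _ _).inter_of_right _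
  have hsphere : ∀ n ∈ hfin.toFinset, ((sphere d n).ncard : ℝ) ≤ D * (3 * N) ^ a := by
    intro n hn
    have hnN : (n : ℝ) ≤ 2 * N := by exact_mod_cast (hfin.mem_toFinset.1 hn).2.2
    exact (hD n).trans (by gcongr; linarith)
  calc ((Λ ∩ Set.Icc N (2 * N)).ncard : ℝ) = hfin.toFinset.card := by
        rw [Set.ncard_eq_toFinset_card _ hfin]
    _ ≤ C * (D * (3 * N) ^ a) ^ (p - 1) := hC _ _ (by simp) (by positivity) hsphere
    _ = C * (D * 3 ^ a) ^ (p - 1) * N ^ ((p - 1) * a) := by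
        rw [Real.mul_rpow (x := 3) (by positivity) (by positivity), ← mul_assoc (D : ℝ),
          Real.mul_rpow (by positivity) (by positivity), ← Real.rpow_mul (by positivity),
          mul_comm a, mul_assoc]

theorem tendsto_log_one_div_nhdsGT_zero :
    Tendsto (fun ε : ℝ≥0 => Real.log (1 / (ε : ℝ))) (𝓝[>] 0) atTop := by
  have hcoe : Tendsto (fun ε : ℝ≥0 => (ε : ℝ)) (𝓝[>] 0) (𝓝[>] 0) :=
    tendsto_nhdsWithin_iff.2 ⟨(NNReal.continuous_coe.tendsto 0).mono_left nhdsWithin_le_nhds,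
      eventually_mem_nhdsWithin.mono fun ε hε => NNReal.coe_pos.2 hε⟩
  simp only [one_div]
  exact Real.tendsto_log_atTop.comp (tendsto_inv_nhdsGT_zero.comp hcoe)

/- A covering number `N ε = 0` is harmless, since `Real.log 0 = 0`. -/
theorem limsup_log_div_log_le {N : ℝ≥0 → ℕ} {A σ : ℝ} (hσ : 0 ≤ σ)
    (hN : ∀ᶠ ε : ℝ≥0 in 𝓝[>] 0, (N ε : ℝ) ≤ A * (1 / (ε : ℝ)) ^ σ) :
    limsup (fun ε : ℝ≥0 => Real.log (N ε) / Real.log (1 / (ε : ℝ))) (𝓝[>] 0) ≤ σ := by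
  have hlim : Tendsto (fun ε : ℝ≥0 => Real.log (max 1 A) / Real.log (1 / (ε : ℝ)) + σ)
      (𝓝[>] 0) (𝓝 σ) := by
    simpa using (tendsto_log_one_div_nhdsGT_zero.const_div_atTop (Real.log (max 1 A))).add_const σ
  have hlog : ∀ᶠ ε : ℝ≥0 in 𝓝[>] 0, 0 < Real.log (1 / (ε : ℝ)) :=
    tendsto_log_one_div_nhdsGT_zero.eventually_gt_atTop 0
  rw [← hlim.limsup_eq]
  refine limsup_le_limsup ?_ (isCoboundedUnder_le_of_eventually_le (x := 0) _ ?_)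
    hlim.isBoundedUnder_le
  · filter_upwards [hN, hlog, eventually_mem_nhdsWithin] with ε hNε hlogε hε
    have hε0 : (0 : ℝ) < 1 / ε := one_div_pos.2 (by exact_mod_cast hε)
    have hlogN : Real.log (N ε) ≤ Real.log (max 1 A) + σ * Real.log (1 / (ε : ℝ)) := by
      rcases Nat.eq_zero_or_pos (N ε) with hzero | hpos
      · rw [hzero, Nat.cast_zero, Real.log_zero]
        exact add_nonneg (Real.log_nonneg (le_max_left _ _)) (by positivity)
      · rw [← Real.log_rpow hε0, ← Real.log_mul (by positivity) (by positivity)]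
        refine Real.log_le_log (by exact_mod_cast hpos) (hNε.trans ?_)
        gcongr
        exact le_max_right _ _
    calc Real.log (N ε) / Real.log (1 / (ε : ℝ))
        ≤ (Real.log (max 1 A) + σ * Real.log (1 / (ε : ℝ))) / Real.log (1 / (ε : ℝ)) := by gcongr
      _ = Real.log (max 1 A) / Real.log (1 / (ε : ℝ)) + σ := by
          rw [add_div, mul_div_cancel_right₀ _ hlogε.ne']
  · filter_upwards [hlog] with ε hlogε
    exact div_nonneg (Real.log_natCast_nonneg _) hlogε.le

section Padic

variable {q : ℕ} [Fact q.Prime]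

theorem edist_natCast_padicInt_le {k n m : ℕ} (h : (n : ZMod (q ^ k)) = m) {ε : ℝ≥0}
    (hε : ((q : ℝ) ^ k)⁻¹ ≤ ε) : edist (n : ℤ_[q]) (m : ℤ_[q]) ≤ ε := by
  have hdvd : ((q : ℤ) ^ k) ∣ (n : ℤ) - m := by
    have hzero : (((n : ℤ) - m : ℤ) : ZMod (q ^ k)) = 0 := by simp [h]
    exact_mod_cast (ZMod.intCast_zmod_eq_zero_iff_dvd _ _).1 hzero
  have hnorm : ‖(n : ℤ_[q]) - m‖ ≤ ((q : ℝ) ^ k)⁻¹ := by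
    simpa using (PadicInt.norm_int_le_pow_iff_dvd (p := q)).2 hdvd
  rw [edist_nndist, ENNReal.coe_le_coe, ← NNReal.coe_le_coe, coe_nndist, dist_eq_norm]
  exact hnorm.trans hε

theorem exists_finset_coveringNumber_le_card (q : ℕ) [Fact q.Prime] (Λ : Set ℕ) (k : ℕ) :
    ∃ F : Finset ℕ, (F : Set ℕ) ⊆ Λ ∧ Set.InjOn (Nat.cast : ℕ → ZMod (q ^ k)) F ∧
      ∀ ε : ℝ≥0, ((q : ℝ) ^ k)⁻¹ ≤ ε →
        Metric.coveringNumber ε ((fun n : ℕ => (n : ℤ_[q])) '' Λ) ≤ F.card := by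
  have : NeZero (q ^ k) := ⟨pow_ne_zero _ (Fact.out : q.Prime).ne_zero⟩
  obtain ⟨s, hsΛ, hs⟩ :=
    (Set.surjOn_image (Nat.cast : ℕ → ZMod (q ^ k)) Λ).exists_bijOn_subset
  have hfin : s.Finite := Set.Finite.of_finite_image (Set.toFinite _) hs.injOn
  refine ⟨hfin.toFinset, by simpa using hsΛ, by simpa using hs.injOn, fun ε hε => ?_⟩
  have hcover : Metric.IsCover ε ((fun n : ℕ => (n : ℤ_[q])) '' Λ)
      ((fun n : ℕ => (n : ℤ_[q])) '' s) := by
    rintro _ ⟨n, hn, rfl⟩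
    obtain ⟨m, hm, hmn⟩ := hs.surjOn ⟨n, hn, rfl⟩
    exact ⟨m, ⟨m, hm, rfl⟩, edist_natCast_padicInt_le hmn.symm hε⟩
  rw [← hfin.encard_eq_coe_toFinset_card]
  exact (hcover.coveringNumber_le_encard (Set.image_mono hsΛ)).trans (Set.encard_image_le _ _)

theorem padicDim_le_of_forall_card_le {Λ : Set ℕ} {A : ℝ≥0} {σ : ℝ} (hσ : 0 ≤ σ)
    (h : ∀ (k : ℕ) (F : Finset ℕ), (F : Set ℕ) ⊆ Λ →
      Set.InjOn (Nat.cast : ℕ → ZMod (q ^ k)) F → (F.card : ℝ) ≤ A * ((q : ℝ) ^ k) ^ σ) :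
    padicDim q Λ ≤ σ := by
  have hq : (1 : ℝ) < q := by exact_mod_cast (Fact.out : q.Prime).one_lt
  refine limsup_log_div_log_le (A := A * (q : ℝ) ^ σ) hσ ?_
  filter_upwards [Ioo_mem_nhdsGT (zero_lt_one' ℝ≥0)] with ε hε
  have hε0 : (0 : ℝ) < ε := by exact_mod_cast hε.1
  have hε1 : (1 : ℝ) ≤ 1 / ε := (one_le_div hε0).2 (by exact_mod_cast hε.2.le)
  obtain ⟨j, hj, hj'⟩ := exists_nat_pow_near hε1 hq
  obtain ⟨F, hF, hFinj, hcover⟩ := exists_finset_coveringNumber_le_card q Λ (j + 1)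
  have hcover' := hcover ε (by rw [inv_le_comm₀ (by positivity) hε0, ← one_div]; exact hj'.le)
  calc ((Metric.coveringNumber ε ((fun n : ℕ => (n : ℤ_[q])) '' Λ)).toNat : ℝ)
      ≤ F.card := by exact_mod_cast ENat.toNat_le_of_le_natCast hcover'
    _ ≤ A * ((q : ℝ) ^ (j + 1)) ^ σ := h (j + 1) F hF hFinj
    _ ≤ A * (q * (1 / (ε : ℝ))) ^ σ := by
        rw [pow_succ']
        gcongr
    _ = A * (q : ℝ) ^ σ * (1 / (ε : ℝ)) ^ σ := by
        rw [Real.mul_rpow (by positivity) (by positivity), mul_assoc]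

theorem IsBoundedMaximal.padicDim_le {d : ℕ} (hd : 2 ≤ d) {Λ : Set ℕ} {p : ℝ} (hp : 1 ≤ p)
    (hΛ : ∀ n ∈ Λ, (sphere d n).Nonempty) (h : IsBoundedMaximal d Λ p) (q : ℕ) [Fact q.Prime] :
    padicDim q Λ ≤ (p - 1) * ((d : ℝ) - 1) := by
  have hp0 : 0 ≤ p - 1 := by linarith
  have hd' : (2 : ℝ) ≤ d := by exact_mod_cast hd
  refine le_mul_of_forall_pos_le_mul_add fun ε hε => ?_
  obtain ⟨C, hC⟩ := h.exists_card_le_of_card_sphereMod_le hp hΛ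
  obtain ⟨D, hD⟩ := exists_card_sphereMod_le hd hε
  refine padicDim_le_of_forall_card_le (A := C * D ^ (p - 1))
    (mul_nonneg hp0 (by linarith)) fun k F hF hinj => ?_
  have : NeZero (q ^ k) := ⟨pow_ne_zero _ (Fact.out : q.Prime).ne_zero⟩
  calc (F.card : ℝ) ≤ C * (D * ((q ^ k : ℕ) : ℝ) ^ ((d : ℝ) - 1 + ε)) ^ (p - 1) :=
        hC (q ^ k) F _ hF hinj (hD (q ^ k))
    _ = (C * D ^ (p - 1) : ℝ≥0) * ((q : ℝ) ^ k) ^ ((p - 1) * ((d : ℝ) - 1 + ε)) := by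
        push_cast
        rw [Real.mul_rpow (by positivity) (by positivity), ← Real.rpow_mul (by positivity),
          mul_assoc, mul_comm (p - 1)]

end Padic

theorem IsBoundedMaximal.eta_le {d : ℕ} (hd : 3 ≤ d) {Λ : Set ℕ} {p : ℝ} (hp : 1 ≤ p)
    (hΛ : ∀ n ∈ Λ, (sphere d n).Nonempty) (h : IsBoundedMaximal d Λ p) : eta d Λ ≤ p := by
  have hd' : (3 : ℝ) ≤ d := by exact_mod_cast hd
  have : Nonempty Nat.Primes := ⟨⟨2, Nat.prime_two⟩⟩
  refine max_le (ciSup_le fun q => ?_) ?_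
  · have : Fact (q : ℕ).Prime := ⟨q.2⟩
    rw [← le_sub_iff_add_le', div_le_iff₀ (by linarith)]
    exact h.padicDim_le (by omega) hp hΛ q
  · rw [← le_sub_iff_add_le', div_le_iff₀ (by linarith)]
    linarith [h.growthExp_le (by omega) hp hΛ]

theorem not_isBoundedMaximal_of_infinite {d : ℕ} {Λ : Set ℕ} {p : ℝ} (hp0 : 0 < p) (hp : p ≤ 1)
    (hΛ : ∀ n ∈ Λ, (sphere d n).Nonempty) (hinf : Λ.Infinite) : ¬ IsBoundedMaximal d Λ p := by
  intro h
  obtain ⟨C, hC⟩ := h.exists_sum_ncard_sphere_rpow_le hp0 hΛ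
  obtain ⟨F, hF, hcard⟩ := hinf.exists_subset_card_eq (⌊C⌋₊ + 1)
  have hone : ∀ n ∈ F, (1 : ℝ) ≤ ((sphere d n).ncard : ℝ) ^ (1 - p) := fun n hn =>
    Real.one_le_rpow (by exact_mod_cast (Set.ncard_pos (sphere_finite d n)).2 (hΛ n (hF hn)))
      (by linarith)
  have hle : (F.card : ℝ) ≤ C := by
    simpa using (Finset.card_nsmul_le_sum F _ 1 hone).trans (hC F hF)
  rw [hcard] at hle
  exact (Nat.lt_floor_add_one C).not_ge (by exact_mod_cast hle)

end Dimension

end ArithSphere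

theorem theorem1_general (d : ℕ) (hd : 3 ≤ d) (Λ : Set ℕ)
    (hΛ : ∀ n ∈ Λ, (ArithSphere.sphere d n).Nonempty) (p : ℝ) (hp0 : 0 < p)
    (hp1 : 1 ≤ p ∨ Λ.Infinite) (hp : p < ArithSphere.eta d Λ) :
    ¬ ArithSphere.IsBoundedMaximal d Λ p := by
  rcases le_or_gt 1 p with h1 | h1
  · exact fun h => (h.eta_le hd h1 hΛ).not_gt hp
  · exact ArithSphere.not_isBoundedMaximal_of_infinite hp0 h1.le hΛ (hp1.resolve_left h1.not_ge)

theorem theorem1 (d : ℕ) (hd : 4 ≤ d) (Λ : Set ℕ) (p : ℝ) (hp0 : 0 < p)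
    (hp1 : 1 ≤ p ∨ Λ.Infinite) (hp : p < ArithSphere.eta d Λ) :
    ¬ ArithSphere.IsBoundedMaximal d Λ p :=
  theorem1_general d (by omega) Λ (fun n _ => ArithSphere.sphere_nonempty hd n) p hp0 hp1 hp
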